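/- Let $\Delta\subset\mathbb{R}^2$ be a convex lattice polygon with sides $\Gamma_1,\dots,\Gamma_m$ ($m\ge 3$) in anticlockwise order, let $d_i=|\Gamma_i\cap\mathbb{Z}^2|-1$ be the integer length of $\Gamma_i$, $u_i\in\mathbb{Z}^2$ its primitive inner normal vector, and $n=\sum_i d_i$. Write $x\wedge y$ for the determinant of the matrix with columns $x,y\in\mathbb{R}^2$. For a tuple $a=(a_{i,j})_{1\le i\le m,\,1\le j\le d_i}\in\mathbb{R}^n$ of root parameters with $a_{i,j}\ne a_{k,l}$ whenever $u_i\ne u_k$, the tentacle positions are \[ \rho_{i,j}(a)=\sum_{k=1}^m\sum_{l=1}^{d_k} (u_k\wedge u_i)\,\log|a_{i,j}-a_{k,l}| \] (terms with $k=i$ are $0$). Let two such tuples be equivalent if some element of $\mathrm{PGL}(2,\mathbb{R})$, acting on $\mathbb{RP}^1=\mathbb{R}\cup\{\infty\}$ by Möbius transformations, carries one to the other entry by entry. Let $\mathbb{R}^2$ act on tentacle positions by translations $\rho_{i,j}\mapsto\rho_{i,j}+x\wedge u_i$ ($x\in\mathbb{R}^2$). Then $\rho$ induces a well-defined map $\tilde\rho$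 from root parameters modulo $\mathrm{PGL}(2,\mathbb{R})$ to $\mathbb{R}^n/\mathbb{R}^2\cong\mathbb{R}^{n-2}$. Let $\mathcal{H}_{0,\Delta}$, the moduli space of rational Harnack curves with Newton polygon $\Delta$ modulo the torus action, be regarded as a subset of the space of root parameters modulo $\mathrm{PGL}(2,\mathbb{R})$, namely the set of classes of those $a\in\mathbb{R}^n$ for which $a_{i,j}\le a_{i,j'}$ if $j\le j'$, and $a_{i,j}<a_{k,l}$ if $i<k$ (the class of $a$ corresponds to the curve parametrized by $t\mapsto\prod_{i,j}(t-a_{i,j})^{u_i}$). It carries the smooth structure of the quotient: a map from $\mathcal{H}_{0,\Delta}$ to a finite-dimensional vector space is smooth if its pullback to root parameters is smooth, and a map from a subset of a vector space to $\mathcal{H}_{0,\Delta}$ is smooth if locally it is given by root parameters that depend smoothly on the point. (Smoothness on a subset of a vector space means local extendability to a smooth map on an open set.) **Theorem.** The restriction $\tilde\rho|_{\mathcal{H}_{0,\Delta}}$ is a diffeomorphism onto its image: it is smooth and injective, and its inverse $\tilde\rho(\mathcal{H}_{0,\Delta})\to\mathcal{H}_{0,\Delta}$ is smooth. -/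

import Mathlib

open scoped ContDiff

noncomputable section

/-- The determinant of the `2 × 2` matrix with columns `x` and `y`. -/
def wedge {R : Type*} [CommRing R] (x y : R × R) : R := x.1 * y.2 - x.2 * y.1

/-- A convex lattice polygon with `m ≥ 3` sides, given by its vertices in cyclic anticlockwise
order: every vertex that is not an endpoint of the `i`-th side lies strictly to the left of the
line through that side, oriented from the `i`-th vertex to the next one. -/
structure LatticePolygon (m : ℕ) where
  three_le : 3 ≤ m
  vertex : Fin m → ℤ × ℤ
  convex : ∀ i k : Fin m, k ≠ i → k ≠ finRotate m i →
    0 < wedge (vertex (finRotate m i) - vertex i) (vertex k - vertex i)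

namespace LatticePolygon

variable {m : ℕ} (Δ : LatticePolygon m)

/-- The `i`-th side of the polygon, as a vector oriented anticlockwise. -/
def side (i : Fin m) : ℤ × ℤ := Δ.vertex (finRotate m i) - Δ.vertex i

/-- The integer length of the `i`-th side: the number of its lattice points minus one. -/
def len (i : Fin m) : ℕ := Int.gcd (Δ.side i).1 (Δ.side i).2

/-- The primitive inner normal vector of the `i`-th side. -/
def normal (i : Fin m) : ℤ × ℤ := (-(Δ.side i).2 / Δ.len i, (Δ.side i).1 / Δ.len i)

/-- The primitive inner normal vector of the `i`-th side, as a vector in the real plane. -/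
def normalR (i : Fin m) : ℝ × ℝ := ((Δ.normal i).1, (Δ.normal i).2)

/-- The index set of the root parameters: pairs `(i, j)`, where `i` is a side and `j` runs through
as many values as the integer length of that side. It has as many elements as there are lattice
points in the boundary of the polygon. -/
abbrev RootIndex : Type := Σ i : Fin m, Fin (Δ.len i)

lemma len_mul_normal (i : Fin m) :
    (Δ.len i : ℤ) * (Δ.normal i).1 = -(Δ.side i).2 ∧
      (Δ.len i : ℤ) * (Δ.normal i).2 = (Δ.side i).1 :=
  ⟨Int.mul_ediv_cancel' ((Int.gcd_dvd_right _ _).neg_right),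
    Int.mul_ediv_cancel' (Int.gcd_dvd_left _ _)⟩

/-- The balancing condition. -/
lemma sum_normalR :
    (∑ p : Δ.RootIndex, (Δ.normalR p.1).1 = 0) ∧ ∑ p : Δ.RootIndex, (Δ.normalR p.1).2 = 0 := by
  have key : ∑ i, Δ.side i = 0 := by
    simp only [side, Finset.sum_sub_distrib]
    rw [Equiv.sum_comp (finRotate m) Δ.vertex, sub_self]
  have h1 := congrArg Prod.fst key
  have h2 := congrArg Prod.snd key
  rw [Prod.fst_sum] at h1
  rw [Prod.snd_sum] at h2
  constructor
  · rw [Fintype.sum_sigma]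
    have : ∀ i : Fin m, ∑ _j : Fin (Δ.len i), (Δ.normalR i).1 = ((-(Δ.side i).2 : ℤ) : ℝ) := by
      intro i
      rw [← (Δ.len_mul_normal i).1]
      simp [normalR]
    simp only [this]
    rw [← Int.cast_sum, Finset.sum_neg_distrib, h2]
    simp
  · rw [Fintype.sum_sigma]
    have : ∀ i : Fin m, ∑ _j : Fin (Δ.len i), (Δ.normalR i).2 = (((Δ.side i).1 : ℤ) : ℝ) := by
      intro i
      rw [← (Δ.len_mul_normal i).2]
      simp [normalR]
    simp only [this]
    rw [← Int.cast_sum, h1]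
    simp

/-- The set of tuples of real root parameters in which roots that belong to sides with distinct
normal vectors are distinct. -/
def rootSet : Set (Δ.RootIndex → ℝ) :=
  {a | ∀ p q : Δ.RootIndex, Δ.normal p.1 ≠ Δ.normal q.1 → a p ≠ a q}

/-- Two tuples of root parameters are equivalent if a Möbius transformation of the real projective
line `ℝ ∪ {∞}` carries one to the other. The scalar matrices in `GL(2, ℝ)` act trivially, so that
the classes are those of `PGL(2, ℝ)`. -/
def rootSetoid : Setoid Δ.rootSet where
  r a b := ∃ g : GL (Fin 2) ℝ, ∀ p : Δ.RootIndex,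
    g • ((a : Δ.RootIndex → ℝ) p : OnePoint ℝ) = (((b : Δ.RootIndex → ℝ) p : ℝ) : OnePoint ℝ)
  iseqv :=
    { refl := fun a => ⟨1, fun p => one_smul _ _⟩
      symm := fun {a b} ⟨g, hg⟩ => ⟨g⁻¹, fun p => by rw [← hg p, inv_smul_smul]⟩
      trans := fun {a b c} ⟨g, hg⟩ ⟨h, hh⟩ => ⟨h * g, fun p => by rw [mul_smul, hg p, hh p]⟩ }

/-- The space of root parameters modulo `PGL(2, ℝ)`. -/
def RootModuli : Type := Quotient Δ.rootSetoid

/-- The class of a tuple of root parameters modulo `PGL(2, ℝ)`. -/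
def rootClass (a : Δ.rootSet) : Δ.RootModuli := Quotient.mk Δ.rootSetoid a

/-- The roots of each side are in non-decreasing order, and the roots of each side are strictly
smaller than those of all later sides. -/
def LexOrdered (a : Δ.RootIndex → ℝ) : Prop :=
  (∀ i : Fin m, ∀ j j' : Fin (Δ.len i), j ≤ j' → a ⟨i, j⟩ ≤ a ⟨i, j'⟩) ∧
    ∀ i i' : Fin m, i < i' → ∀ (j : Fin (Δ.len i)) (j' : Fin (Δ.len i')), a ⟨i, j⟩ < a ⟨i', j'⟩

/-- The moduli space of rational Harnack curves with Newton polygon `Δ` modulo the torus action,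
as a subset of the space of root parameters modulo `PGL(2, ℝ)`: the class of a lexicographically
ordered tuple `a` represents the curve that is parametrized by
`φ(t) = ∏ p, (t - a p) ^ (normal p.1)`. -/
def rationalHarnack : Set Δ.RootModuli :=
  {c | ∃ a : Δ.rootSet, Δ.LexOrdered a ∧ Δ.rootClass a = c}

/-- The positions of the tentacles,
`ρ p = log |φ(a p) ^ (J u p)| = ∑ q, (u q ∧ u p) * log |a p - a q|`.
When `a p = a q`, then `u q ∧ u p = 0` and the term is zero. -/
def rho (a : Δ.RootIndex → ℝ) (p : Δ.RootIndex) : ℝ :=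
  ∑ q : Δ.RootIndex, wedge (Δ.normalR q.1) (Δ.normalR p.1) * Real.log |a p - a q|

/-- The vector by which a translation of the plane by `x` changes the tentacle positions. -/
def translationMap : ℝ × ℝ →ₗ[ℝ] (Δ.RootIndex → ℝ) where
  toFun x p := wedge x (Δ.normalR p.1)
  map_add' x y := by ext p; simp only [wedge, Prod.fst_add, Prod.snd_add, Pi.add_apply]; ring
  map_smul' r x := by
    ext p
    simp only [wedge, Prod.smul_fst, Prod.smul_snd, Pi.smul_apply, smul_eq_mul, RingHom.id_apply]
    ring

/-- The subspace of the changes of tentacle positions by translations of the plane. -/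
def translations : Submodule ℝ (Δ.RootIndex → ℝ) := LinearMap.range Δ.translationMap

instance : IsClosed (Δ.translations : Set (Δ.RootIndex → ℝ)) :=
  Submodule.closed_of_finiteDimensional _

/-- Tentacle positions modulo translations of the plane, a finite-dimensional normed space. -/
abbrev TentacleSpace : Type := (Δ.RootIndex → ℝ) ⧸ Δ.translations

lemma rho_sub_rho_mem (a b : Δ.rootSet) (h : Δ.rootSetoid.r a b) :
    Δ.rho b - Δ.rho a ∈ Δ.translations := by
  obtain ⟨g, hg⟩ := h
  set A : Δ.RootIndex → ℝ := a.1
  set B : Δ.RootIndex → ℝ := b.1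
  set den : Δ.RootIndex → ℝ := fun p => g 1 0 * A p + g 1 1 with hden
  have hne : ∀ p, den p ≠ 0 := by
    intro p h0
    have := hg p
    rw [OnePoint.smul_some_eq_ite, if_pos h0] at this
    exact OnePoint.infty_ne_coe _ this
  have hB : ∀ p, B p = (g 0 0 * A p + g 0 1) / den p := by
    intro p
    have := hg p
    rw [OnePoint.smul_some_eq_ite, if_neg (hne p)] at this
    exact (OnePoint.coe_injective this).symm
  have hdet : g 0 0 * g 1 1 - g 0 1 * g 1 0 ≠ 0 := by
    have := g.det_ne_zero
    rwa [Matrix.det_fin_two] at this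
  set D : ℝ := g 0 0 * g 1 1 - g 0 1 * g 1 0 with hD
  refine ⟨-∑ q : Δ.RootIndex, Real.log |den q| • Δ.normalR q.1, ?_⟩
  have term : ∀ p q : Δ.RootIndex,
      wedge (Δ.normalR q.1) (Δ.normalR p.1) * Real.log |B p - B q| =
      wedge (Δ.normalR q.1) (Δ.normalR p.1) * Real.log |A p - A q| +
      wedge (Δ.normalR q.1) (Δ.normalR p.1) * (Real.log |D| - Real.log |den p|) -
      wedge (Δ.normalR q.1) (Δ.normalR p.1) * Real.log |den q| := by
    intro p q
    by_cases hpq : Δ.normal p.1 = Δ.normal q.1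
    · have : wedge (Δ.normalR q.1) (Δ.normalR p.1) = 0 := by
        simp only [wedge, normalR, hpq]; ring
      simp [this]
    · have hA : A p - A q ≠ 0 := sub_ne_zero.mpr (a.2 p q hpq)
      have e : B p - B q = D * (A p - A q) / (den p * den q) := by
        rw [hB p, hB q, div_sub_div _ _ (hne p) (hne q)]
        congr 1
        simp only [hden, hD]; ring
      rw [Real.log_abs, e, Real.log_div (mul_ne_zero hdet hA) (mul_ne_zero (hne p) (hne q)),
        Real.log_mul hdet hA, Real.log_mul (hne p) (hne q)]
      simp only [Real.log_abs]
      ring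
  have zero : ∀ p : Δ.RootIndex,
      ∑ q : Δ.RootIndex, wedge (Δ.normalR q.1) (Δ.normalR p.1) = 0 := by
    intro p
    simp only [wedge, Finset.sum_sub_distrib, ← Finset.sum_mul, Δ.sum_normalR.1,
      Δ.sum_normalR.2, zero_mul, sub_zero]
  ext p
  change Δ.translationMap _ p = Δ.rho B p - Δ.rho A p
  unfold rho
  rw [Finset.sum_congr rfl (fun q _ => term p q), Finset.sum_sub_distrib,
    Finset.sum_add_distrib, ← Finset.sum_mul, zero p, map_neg, map_sum]
  simp only [zero_mul, add_zero, sub_sub_cancel_left, Pi.neg_apply, Finset.sum_apply, map_smul,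
    Pi.smul_apply, smul_eq_mul]
  congr 1
  refine Finset.sum_congr rfl fun q _ => ?_
  rw [mul_comm]
  rfl

/-- The map from root parameters modulo `PGL(2, ℝ)` to tentacle positions modulo translations that
is induced by `rho`. -/
def rhoTilde : Δ.RootModuli → Δ.TentacleSpace :=
  Quotient.lift (fun a : Δ.rootSet => Submodule.Quotient.mk (Δ.rho a)) fun a b h => by
    refine ((Submodule.Quotient.eq _).2 ?_).symm
    exact Δ.rho_sub_rho_mem a b h

/-- A map `F` from a set `H` of classes of root parameters to a normed space is smooth if its
composition with the quotient map is smooth on the preimage of `H`, that is, extends to a smooth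
map in a neighbourhood of each point of that preimage. -/
def SmoothOn {V : Type*} [NormedAddCommGroup V] [NormedSpace ℝ V] (H : Set Δ.RootModuli)
    (F : Δ.RootModuli → V) : Prop :=
  ∀ a : Δ.rootSet, Δ.rootClass a ∈ H →
    ∃ U : Set (Δ.RootIndex → ℝ), IsOpen U ∧ (a : Δ.RootIndex → ℝ) ∈ U ∧
      ∃ f : (Δ.RootIndex → ℝ) → V, ContDiffOn ℝ ∞ f U ∧
        ∀ b : Δ.rootSet, (b : Δ.RootIndex → ℝ) ∈ U → Δ.rootClass b ∈ H → F (Δ.rootClass b) = f b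

/-- A map `G` from a subset `S` of a normed space to classes of root parameters is smooth if
locally on `S` it is given by root parameters that are smooth, that is, that extend to smooth
functions on an open set of the normed space. -/
def SmoothInto {V : Type*} [NormedAddCommGroup V] [NormedSpace ℝ V] (S : Set V)
    (G : V → Δ.RootModuli) : Prop :=
  ∀ y ∈ S, ∃ U : Set V, IsOpen U ∧ y ∈ U ∧
    ∃ f : V → (Δ.RootIndex → ℝ), ContDiffOn ℝ ∞ f U ∧
      ∀ z ∈ S ∩ U, ∃ hz : f z ∈ Δ.rootSet, Δ.rootClass ⟨f z, hz⟩ = G z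

/-- `F` restricts to a diffeomorphism from `H` onto the image `F '' H`: it is smooth on `H`, and it
has a smooth inverse `F '' H → H`. -/
def IsDiffeoOntoImage {V : Type*} [NormedAddCommGroup V] [NormedSpace ℝ V]
    (H : Set Δ.RootModuli) (F : Δ.RootModuli → V) : Prop :=
  Δ.SmoothOn H F ∧ ∃ G : V → Δ.RootModuli, (∀ c ∈ H, G (F c) = c) ∧ Δ.SmoothInto (F '' H) G

end LatticePolygon

end

noncomputable section

/-! The Jacobian of `rho` at `a` is symmetric, and its quadratic form is half the sum over pairs of
`(u_p ∧ u_q) (v_q - v_p)² / (a_q - a_p)`, whose terms have mixed signs. Balancing of the normals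
rewrites it, up to the factor `6 * perimeter`, as a sum over triples of roots
(`six_perimeter_mul_quadratic`). In a triple from three distinct sides, the three fractions combine
into `N² / V`, where `V` is the Vandermonde product of the roots and `N` is the determinant with
rows `1`, `a`, `v`. The coefficient is the signed area of the triangle spanned by the three unit
normals, scaled by the lengths of the normals. By convexity it has the sign of `V` when the roots
follow the cyclic order of the sides. Hence the form is positive semidefinite, and its kernel
consists of affine functions of the roots.

To remove the Möbius action, each class is represented by a tuple with sum zero and both moments
about the first and the last side equal to `-1` (`exists_normalized`). These three conditions are
affine, and their direction space `L` is orthogonal to the translations. No nonzero affine function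
of the roots lies in `L`, so the form is positive definite there (`inner_rhoEDeriv_pos`).

Tuples ordered only between sides form an open convex set. On it, monotonicity along segments gives
injectivity modulo `Lᗮ` (`eq_of_sub_mem_orthogonal`), and the inverse function theorem gives a
smooth inverse (`exists_smooth_inverse`). -/

lemma wedge_comm_neg {R : Type*} [CommRing R] (x y : R × R) : wedge x y = -wedge y x := by
  simp only [wedge]; ring

namespace LatticePolygon

variable {m : ℕ} (Δ : LatticePolygon m)

/-! ### Turning of the sides of a convex polygon -/

lemma finRotate_val_of_lt {i : Fin m} (h : i.val + 1 < m) : (finRotate m i).val = i.val + 1 := by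
  obtain ⟨n, rfl⟩ : ∃ n, m = n + 1 := ⟨m - 1, by omega⟩
  obtain ⟨i, hi⟩ := i
  rw [finRotate_of_lt (by simp at h; omega)]

lemma finRotate_val_of_eq {i : Fin m} (h : i.val + 1 = m) : (finRotate m i).val = 0 := by
  obtain ⟨n, rfl⟩ : ∃ n, m = n + 1 := ⟨m - 1, by omega⟩
  have : i = Fin.last n := Fin.ext (by simp; omega)
  rw [this, finRotate_last]
  rfl

/-- Consecutive sides make a left turn. -/
lemma wedge_side_rotate_pos (j : Fin m) :
    0 < wedge (Δ.side j) (Δ.side (finRotate m j)) := by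
  have h3 := Δ.three_le
  have hne : finRotate m (finRotate m j) ≠ j ∧ finRotate m j ≠ j := by
    rcases Nat.lt_or_ge (j.val + 1) m with h | h
    · have e1 := finRotate_val_of_lt h
      rcases Nat.lt_or_ge (j.val + 2) m with h' | h'
      · have e2 := finRotate_val_of_lt (i := finRotate m j) (by omega)
        constructor <;> intro h0 <;> have := congrArg Fin.val h0 <;> omega
      · have e2 := finRotate_val_of_eq (i := finRotate m j) (by omega)
        constructor <;> intro h0 <;> have := congrArg Fin.val h0 <;> omega
    · have e1 := finRotate_val_of_eq (i := j) (by omega)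
      have e2 := finRotate_val_of_lt (i := finRotate m j) (by omega)
      constructor <;> intro h0 <;> have := congrArg Fin.val h0 <;> omega
  have h := Δ.convex j _ hne.1 (fun h => hne.2 ((finRotate m).injective h))
  simp only [wedge, side, Prod.fst_sub, Prod.snd_sub] at h ⊢
  linarith

/-- Once the sides have turned by at least a half turn from side `i`, they keep doing so until
side `i` is reached again. -/
lemma wedge_side_rotate_neg {i j : Fin m} (hij : j ≠ i) (hij' : finRotate m j ≠ i)
    (h : wedge (Δ.side i) (Δ.side j) ≤ 0) :
    wedge (Δ.side i) (Δ.side (finRotate m j)) < 0 := by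
  by_contra! hc
  have h1 := Δ.wedge_side_rotate_pos j
  have h2 := Δ.convex i _ hij' (fun h => hij ((finRotate m).injective h))
  have h3 := Δ.convex j i hij.symm hij'.symm
  have h4 : 0 ≤ wedge (Δ.side (finRotate m j)) (Δ.vertex i - Δ.vertex (finRotate m j)) := by
    by_cases h0 : i = finRotate m (finRotate m j)
    · rw [h0]
      simp only [wedge, side, Prod.fst_sub, Prod.snd_sub]
      apply le_of_eq
      ring
    · exact (Δ.convex _ i hij'.symm h0).le
  -- These products are the three terms of the Plücker relation between sides `i`, `j`, the side
  -- after `j`, and the vector from the end of side `j` to vertex `i`; their signs would be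
  -- incompatible.
  have h5 := mul_nonneg hc h3.le
  have h6 := mul_nonneg (neg_nonneg.2 h) h4
  have h7 := mul_pos h1 h2
  simp only [wedge, side, Prod.fst_sub, Prod.snd_sub] at *
  nlinarith

lemma wedge_side_chain {i j k : Fin m} (hjk : j ≤ k) (hi : i < j ∨ k < i)
    (h : wedge (Δ.side i) (Δ.side j) ≤ 0) :
    wedge (Δ.side i) (Δ.side k) ≤ 0 ∧ (j < k → wedge (Δ.side i) (Δ.side k) < 0) := by
  obtain ⟨k, hk⟩ := k
  induction k with
  | zero =>
    have : j = ⟨0, hk⟩ := Fin.ext (by simpa [Fin.le_def] using hjk)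
    exact ⟨this ▸ h, fun h0 => absurd h0 (by simp [this])⟩
  | succ k ih =>
    rcases hjk.eq_or_lt with e | hlt
    · exact ⟨e ▸ h, fun h0 => absurd h0 (by simp [e])⟩
    · have hk' : k < m := by omega
      have e : finRotate m ⟨k, hk'⟩ = ⟨k + 1, hk⟩ := Fin.ext (finRotate_val_of_lt hk)
      simp only [Fin.lt_def, Fin.le_def] at *
      have h1 := (ih hk' (by omega) (by omega)).1
      have h2 := Δ.wedge_side_rotate_neg (i := i) (j := ⟨k, hk'⟩)
        (by simp only [ne_eq, Fin.ext_iff]; omega)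
        (by rw [e]; simp only [ne_eq, Fin.ext_iff]; omega) h1
      rw [e] at h2
      exact ⟨h2.le, fun _ => h2⟩

/-- Among three sides in anticlockwise order, at least two of the three turns are to the left. -/
lemma two_left_turns {i j k : Fin m} (hij : i < j) (hjk : j < k) :
    (0 < wedge (Δ.side i) (Δ.side j) ∧ 0 < wedge (Δ.side j) (Δ.side k)) ∨
    (0 < wedge (Δ.side j) (Δ.side k) ∧ 0 < wedge (Δ.side k) (Δ.side i)) ∨
    (0 < wedge (Δ.side k) (Δ.side i) ∧ 0 < wedge (Δ.side i) (Δ.side j)) := by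
  have a : wedge (Δ.side i) (Δ.side j) ≤ 0 → wedge (Δ.side i) (Δ.side k) < 0 := fun h =>
    (Δ.wedge_side_chain hjk.le (Or.inl hij) h).2 hjk
  have c : wedge (Δ.side k) (Δ.side i) ≤ 0 → wedge (Δ.side k) (Δ.side j) < 0 := fun h =>
    (Δ.wedge_side_chain hij.le (Or.inr hjk) h).2 hij
  have b : wedge (Δ.side j) (Δ.side k) ≤ 0 → wedge (Δ.side j) (Δ.side i) < 0 := by
    intro h
    -- The way from `k` to `i` wraps around: up to the last side, one rotation to the first side,
    -- then on to `i`.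
    have h3 := Δ.three_le
    let l : Fin m := ⟨m - 1, by omega⟩
    let z : Fin m := ⟨0, by omega⟩
    have hl := (Δ.wedge_side_chain (k := l) (by simp only [Fin.le_def, l]; omega)
      (Or.inl hjk) h).1
    have e : finRotate m l = z := Fin.ext (finRotate_val_of_eq (by simp only [l]; omega))
    simp only [Fin.lt_def] at hij hjk
    have hz := Δ.wedge_side_rotate_neg (i := j) (j := l)
      (by simp only [ne_eq, Fin.ext_iff, l]; omega)
      (by rw [e]; simp only [ne_eq, Fin.ext_iff, z]; omega) hl
    rw [e] at hz
    rcases (show z ≤ i by simp only [Fin.le_def, z]; omega).eq_or_lt with h0 | h0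
    · rwa [← h0]
    · exact (Δ.wedge_side_chain h0.le (Or.inr hij) hz.le).2 h0
  rw [wedge_comm_neg (Δ.side i) (Δ.side k)] at a
  rw [wedge_comm_neg (Δ.side j) (Δ.side i)] at b
  rw [wedge_comm_neg (Δ.side k) (Δ.side j)] at c
  by_contra!
  omega

lemma len_pos (i : Fin m) : 0 < Δ.len i := by
  rw [len, Int.gcd_pos_iff]
  by_contra! h
  have := Δ.wedge_side_rotate_pos i
  simp [wedge, h.1, h.2] at this

/-- Normals are the sides after a quarter turn, divided by their integer lengths, and a quarter turn
preserves determinants. -/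
lemma len_mul_wedge (i j : Fin m) :
    (Δ.len i * Δ.len j : ℝ) * wedge (Δ.normalR i) (Δ.normalR j) =
      (wedge (Δ.side i) (Δ.side j) : ℤ) := by
  have hi := Δ.len_mul_normal i
  have hj := Δ.len_mul_normal j
  have e : wedge (Δ.side i) (Δ.side j) =
      (Δ.len i * Δ.len j : ℤ) * wedge (Δ.normal i) (Δ.normal j) := by
    simp only [wedge]
    linear_combination (-(Δ.side j).2) * hi.2 - (Δ.side j).1 * hi.1
      + Δ.len i * (Δ.normal i).2 * hj.1 - Δ.len i * (Δ.normal i).1 * hj.2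
  rw [e]
  simp only [wedge, normalR]
  push_cast
  ring

lemma wedge_normalR_pos_iff (i j : Fin m) :
    0 < wedge (Δ.normalR i) (Δ.normalR j) ↔ 0 < wedge (Δ.side i) (Δ.side j) := by
  have hi : (0 : ℝ) < Δ.len i := Nat.cast_pos.2 (Δ.len_pos i)
  have hj : (0 : ℝ) < Δ.len j := Nat.cast_pos.2 (Δ.len_pos j)
  rw [← Int.cast_pos (R := ℝ), ← Δ.len_mul_wedge, mul_pos_iff_of_pos_left (mul_pos hi hj)]

end LatticePolygon

/-! ### Signed areas of triangles of directions -/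

/-- The Euclidean length of a vector in the plane. -/
def euclidLength (x : ℝ × ℝ) : ℝ := √(x.1 ^ 2 + x.2 ^ 2)

lemma euclidLength_nonneg (x : ℝ × ℝ) : 0 ≤ euclidLength x := Real.sqrt_nonneg _

lemma euclidLength_sq (x : ℝ × ℝ) : euclidLength x ^ 2 = x.1 ^ 2 + x.2 ^ 2 :=
  Real.sq_sqrt (by positivity)

/-- Twice the area of the triangle whose vertices are the unit vectors in the directions of
`x`, `y` and `z`, multiplied by the lengths of these vectors. -/
def directionArea (x y z : ℝ × ℝ) : ℝ :=
  euclidLength z * wedge x y + euclidLength x * wedge y z + euclidLength y * wedge z x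

lemma directionArea_rotate (x y z : ℝ × ℝ) : directionArea y z x = directionArea x y z := by
  unfold directionArea; ring

lemma directionArea_swap (x y z : ℝ × ℝ) :
    directionArea x z y = -directionArea x y z := by
  simp only [directionArea, wedge]; ring

lemma directionArea_self (x y : ℝ × ℝ) : directionArea x x y = 0 := by
  simp only [directionArea, wedge]; ring

/-- If `x ∧ z ≤ 0`, no term is negative. Otherwise `(x ∧ z) y = (y ∧ z) x + (x ∧ y) z` with positive
coefficients, and the claim is the strict triangle inequality for this sum, strict because `x` and
`z` are not parallel. -/
lemma directionArea_pos {x y z : ℝ × ℝ} (hxy : 0 < wedge x y) (hyz : 0 < wedge y z) :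
    0 < directionArea x y z := by
  have hpos : ∀ w : ℝ × ℝ, w ≠ 0 → 0 < euclidLength w := by
    intro w hw
    apply Real.sqrt_pos.2
    by_contra! h
    apply hw
    have h1 : w.1 = 0 := by nlinarith [sq_nonneg w.1, sq_nonneg w.2]
    have h2 : w.2 = 0 := by nlinarith [sq_nonneg w.1, sq_nonneg w.2]
    exact Prod.ext h1 h2
  have hx := hpos x (by rintro rfl; simp [wedge] at hxy)
  have hy := hpos y (by rintro rfl; simp [wedge] at hyz)
  have hz := hpos z (by rintro rfl; simp [wedge] at hyz)
  unfold directionArea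
  rw [wedge_comm_neg z x]
  rcases le_or_gt (wedge x z) 0 with h | h
  · have h1 := mul_pos hz hxy
    have h2 := mul_pos hx hyz
    have h3 := mul_nonneg hy.le (neg_nonneg.2 h)
    linarith
  · suffices wedge x z * euclidLength y < wedge y z * euclidLength x + wedge x y * euclidLength z by
      linarith
    have hx2 := euclidLength_sq x
    have hy2 := euclidLength_sq y
    have hz2 := euclidLength_sq z
    have dot : x.1 * z.1 + x.2 * z.2 < euclidLength x * euclidLength z := by
      apply lt_of_pow_lt_pow_left₀ 2 (by positivity)
      rw [mul_pow, hx2, hz2]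
      have := pow_pos h 2
      simp only [wedge] at this
      linarith
    apply lt_of_pow_lt_pow_left₀ 2 (by positivity)
    have h1 := mul_lt_mul_of_pos_left dot (mul_pos hxy hyz)
    have e : (wedge x z * euclidLength y) ^ 2 =
        wedge y z ^ 2 * (x.1 ^ 2 + x.2 ^ 2) + wedge x y ^ 2 * (z.1 ^ 2 + z.2 ^ 2) +
          2 * (wedge x y * wedge y z * (x.1 * z.1 + x.2 * z.2)) := by
      rw [mul_pow, hy2]
      simp only [wedge]
      ring
    rw [e, ← hx2, ← hz2]
    linarith

namespace LatticePolygon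

variable {m : ℕ} (Δ : LatticePolygon m)

lemma directionArea_normalR_pos {i j k : Fin m} (hij : i < j) (hjk : j < k) :
    0 < directionArea (Δ.normalR i) (Δ.normalR j) (Δ.normalR k) := by
  have h := Δ.two_left_turns hij hjk
  simp only [← wedge_normalR_pos_iff] at h
  rcases h with h | h | h
  · exact directionArea_pos h.1 h.2
  · rw [← directionArea_rotate]
    exact directionArea_pos h.1 h.2
  · rw [← directionArea_rotate, ← directionArea_rotate]
    exact directionArea_pos h.1 h.2

/-- Roots of earlier sides are smaller than roots of later sides. -/
def SideOrdered (a : Δ.RootIndex → ℝ) : Prop :=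
  ∀ p q : Δ.RootIndex, p.1 < q.1 → a p < a q

variable {Δ} in
lemma LexOrdered.sideOrdered {a : Δ.RootIndex → ℝ} (h : Δ.LexOrdered a) : Δ.SideOrdered a :=
  fun p q hpq => h.2 p.1 q.1 hpq p.2 q.2

/-- The difference product of three numbers. -/
def vander (x y z : ℝ) : ℝ := (y - x) * (z - y) * (z - x)

/-- Both factors are alternating, so their product is unchanged by permutations, and it suffices to
treat three sides in increasing order, where both are positive. -/
lemma directionArea_mul_vander_pos {a : Δ.RootIndex → ℝ} (ha : Δ.SideOrdered a)
    {p q r : Δ.RootIndex} (hpq : p.1 ≠ q.1) (hqr : q.1 ≠ r.1) (hpr : p.1 ≠ r.1) :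
    0 < directionArea (Δ.normalR p.1) (Δ.normalR q.1) (Δ.normalR r.1) *
      vander (a p) (a q) (a r) := by
  have key : ∀ p q r : Δ.RootIndex, p.1 < q.1 → q.1 < r.1 →
      0 < directionArea (Δ.normalR p.1) (Δ.normalR q.1) (Δ.normalR r.1) *
        vander (a p) (a q) (a r) := fun p q r h1 h2 =>
    mul_pos (Δ.directionArea_normalR_pos h1 h2) (mul_pos (mul_pos (sub_pos.2 (ha _ _ h1))
      (sub_pos.2 (ha _ _ h2))) (sub_pos.2 (ha _ _ (h1.trans h2))))
  have aux : ∀ x y z : Δ.RootIndex,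
      directionArea (Δ.normalR p.1) (Δ.normalR q.1) (Δ.normalR r.1) * vander (a p) (a q) (a r) =
      directionArea (Δ.normalR x.1) (Δ.normalR y.1) (Δ.normalR z.1) * vander (a x) (a y) (a z) →
      x.1 < y.1 → y.1 < z.1 →
      0 < directionArea (Δ.normalR p.1) (Δ.normalR q.1) (Δ.normalR r.1) *
        vander (a p) (a q) (a r) := fun x y z e h1 h2 => e ▸ key x y z h1 h2
  rcases lt_or_gt_of_ne hpq with h1 | h1 <;> rcases lt_or_gt_of_ne hqr with h2 | h2 <;>
    rcases lt_or_gt_of_ne hpr with h3 | h3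
  · exact key p q r h1 h2
  · exact absurd (h1.trans h2) h3.not_gt
  · exact aux p r q (by simp only [directionArea, wedge, vander]; ring) h3 h2
  · exact aux r p q (by simp only [directionArea, wedge, vander]; ring) h3 h1
  · exact aux q p r (by simp only [directionArea, wedge, vander]; ring) h1 h3
  · exact aux q r p (by simp only [directionArea, wedge, vander]; ring) h2 h3
  · exact absurd (h2.trans h1) h3.not_gt
  · exact aux r q p (by simp only [directionArea, wedge, vander]; ring) h2 h1

lemma directionArea_eq_zero {p q r : Δ.RootIndex} (h : p.1 = q.1 ∨ q.1 = r.1 ∨ p.1 = r.1) :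
    directionArea (Δ.normalR p.1) (Δ.normalR q.1) (Δ.normalR r.1) = 0 := by
  rcases h with h | h | h
  · rw [h, directionArea_self]
  · rw [h, ← directionArea_rotate, directionArea_self]
  · rw [h, ← directionArea_rotate, ← directionArea_rotate, directionArea_self]

/-! ### Smoothness and derivative of the tentacle positions -/

lemma isOpen_rootSet : IsOpen Δ.rootSet := by
  simp only [rootSet, Set.ofPred_forall]
  refine isOpen_iInter_of_finite fun p => isOpen_iInter_of_finite fun q => ?_
  by_cases h : Δ.normal p.1 = Δ.normal q.1
  · simp [h]
  · simpa [h] using isOpen_ne_fun (continuous_apply p) (continuous_apply q)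

variable {Δ} in
lemma SideOrdered.mem_rootSet {a : Δ.RootIndex → ℝ} (h : Δ.SideOrdered a) : a ∈ Δ.rootSet := by
  intro p q hpq
  rcases lt_trichotomy p.1 q.1 with h1 | h1 | h1
  · exact (h p q h1).ne
  · exact absurd (by rw [h1]) hpq
  · exact (h q p h1).ne'

lemma wedge_normalR_eq_zero {p q : Δ.RootIndex} (h : Δ.normal p.1 = Δ.normal q.1) :
    wedge (Δ.normalR p.1) (Δ.normalR q.1) = 0 := by
  simp only [normalR, h, wedge]; ring

/-- The logarithm can be singular only for roots with equal normals, and there its coefficient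
vanishes identically. -/
lemma contDiffOn_rho : ContDiffOn ℝ ∞ Δ.rho Δ.rootSet := by
  rw [contDiffOn_pi]
  intro p
  simp only [rho, Real.log_abs]
  refine ContDiffOn.sum fun q _ => ?_
  by_cases h : Δ.normal q.1 = Δ.normal p.1
  · simp only [Δ.wedge_normalR_eq_zero h, zero_mul]
    exact contDiffOn_const
  · refine contDiffOn_const.mul (ContDiffOn.log ?_ ?_)
    · exact ((contDiff_apply ℝ ℝ p).sub (contDiff_apply ℝ ℝ q)).contDiffOn
    · exact fun a ha => sub_ne_zero.2 (ha p q (Ne.symm h))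

/-- The derivative of the tentacle positions at `a`. -/
def rhoDeriv (a : Δ.RootIndex → ℝ) : (Δ.RootIndex → ℝ) →L[ℝ] (Δ.RootIndex → ℝ) :=
  ContinuousLinearMap.pi fun p => ∑ q : Δ.RootIndex,
    (wedge (Δ.normalR q.1) (Δ.normalR p.1) / (a p - a q)) •
      (ContinuousLinearMap.proj (R := ℝ) (φ := fun _ : Δ.RootIndex => ℝ) p -
        ContinuousLinearMap.proj q)

lemma rhoDeriv_apply (a v : Δ.RootIndex → ℝ) (p : Δ.RootIndex) :
    Δ.rhoDeriv a v p = ∑ q : Δ.RootIndex,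
      wedge (Δ.normalR q.1) (Δ.normalR p.1) / (a p - a q) * (v p - v q) := by
  simp [rhoDeriv]

lemma hasFDerivAt_rho {a : Δ.RootIndex → ℝ} (ha : a ∈ Δ.rootSet) :
    HasFDerivAt Δ.rho (Δ.rhoDeriv a) a := by
  rw [hasFDerivAt_pi']
  intro p
  rw [rhoDeriv, ContinuousLinearMap.proj_pi]
  simp only [rho, Real.log_abs]
  refine HasFDerivAt.fun_sum fun q _ => ?_
  by_cases h : Δ.normal q.1 = Δ.normal p.1
  · simp only [Δ.wedge_normalR_eq_zero h, zero_mul, zero_div, zero_smul]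
    exact hasFDerivAt_const _ _
  · have h1 : HasFDerivAt (fun b : Δ.RootIndex → ℝ => b p - b q)
        (ContinuousLinearMap.proj (R := ℝ) (φ := fun _ : Δ.RootIndex => ℝ) p -
          ContinuousLinearMap.proj q) a :=
      (hasFDerivAt_apply p a).sub (hasFDerivAt_apply q a)
    have h2 := (h1.log (sub_ne_zero.2 (ha p q (Ne.symm h)))).const_mul
      (wedge (Δ.normalR q.1) (Δ.normalR p.1))
    rwa [smul_smul, ← div_eq_mul_inv] at h2

/-! ### The derivative as a semidefinite quadratic form -/

lemma sum_wedge_normalR (x : ℝ × ℝ) : ∑ p : Δ.RootIndex, wedge x (Δ.normalR p.1) = 0 := by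
  simp only [wedge, Finset.sum_sub_distrib, ← Finset.mul_sum, Δ.sum_normalR.1,
    Δ.sum_normalR.2, mul_zero, sub_zero]

/-- The sum of the lengths of the normal vectors. -/
def perimeter : ℝ := ∑ p : Δ.RootIndex, euclidLength (Δ.normalR p.1)

/-- Two of the three terms are linear in the third normal and cancel by balancing. This trades the
pair coefficient `x ∧ y` for triangle areas. -/
lemma sum_directionArea (x y : ℝ × ℝ) :
    ∑ r : Δ.RootIndex, directionArea x y (Δ.normalR r.1) = Δ.perimeter * wedge x y := by
  simp only [directionArea, wedge_comm_neg _ x, Finset.sum_add_distrib, ← Finset.sum_mul,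
    ← Finset.mul_sum, Finset.sum_neg_distrib, Δ.sum_wedge_normalR, perimeter]
  simp

lemma perimeter_nonneg : 0 ≤ Δ.perimeter := Finset.sum_nonneg fun _ _ => euclidLength_nonneg _

/-- The derivative of the tentacle positions as a quadratic form: a sum over triples of roots. -/
lemma six_perimeter_mul_quadratic (a v : Δ.RootIndex → ℝ) :
    6 * Δ.perimeter * ∑ p, v p * Δ.rhoDeriv a v p =
      ∑ p : Δ.RootIndex, ∑ q : Δ.RootIndex, ∑ r : Δ.RootIndex,
        directionArea (Δ.normalR p.1) (Δ.normalR q.1) (Δ.normalR r.1) *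
          ((v q - v p) ^ 2 / (a q - a p) + (v r - v q) ^ 2 / (a r - a q) +
            (v p - v r) ^ 2 / (a p - a r)) := by
  set M : Δ.RootIndex → Δ.RootIndex → ℝ := fun p q => wedge (Δ.normalR p.1) (Δ.normalR q.1)
  set c : Δ.RootIndex → Δ.RootIndex → Δ.RootIndex → ℝ := fun p q r =>
    directionArea (Δ.normalR p.1) (Δ.normalR q.1) (Δ.normalR r.1)
  set D : Δ.RootIndex → Δ.RootIndex → ℝ := fun p q => (v q - v p) ^ 2 / (a q - a p)
  have hrot : ∀ p q r, c q r p = c p q r := fun p q r => directionArea_rotate _ _ _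
  have cyc : ∀ f : Δ.RootIndex → Δ.RootIndex → Δ.RootIndex → ℝ,
      ∑ p, ∑ q, ∑ r, f p q r = ∑ p, ∑ q, ∑ r, f q r p := fun f => Finset.sum_comm_cycle
  -- Symmetrization in `p` and `q`. Coinciding roots cause no trouble, since division by zero gives
  -- zero on both sides.
  have h1 : 2 * ∑ p, v p * Δ.rhoDeriv a v p = ∑ p, ∑ q, M p q * D p q := by
    have e : ∑ p, v p * Δ.rhoDeriv a v p = ∑ p, ∑ q, v p * (M q p / (a p - a q) * (v p - v q)) := by
      simp only [rhoDeriv_apply, Finset.mul_sum, M]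
    rw [two_mul]
    nth_rewrite 1 [e]
    rw [e.trans Finset.sum_comm, ← Finset.sum_add_distrib]
    refine Finset.sum_congr rfl fun p _ => ?_
    rw [← Finset.sum_add_distrib]
    refine Finset.sum_congr rfl fun q _ => ?_
    have e1 : M q p = -M p q := wedge_comm_neg _ _
    have e2 : a p - a q = -(a q - a p) := by ring
    simp only [D, e1, e2, neg_div_neg_eq]
    ring
  have h2 : Δ.perimeter * ∑ p, ∑ q, M p q * D p q = ∑ p, ∑ q, ∑ r, c p q r * D p q := by
    simp only [Finset.mul_sum, ← Finset.sum_mul, c, Δ.sum_directionArea, M, mul_assoc]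
  have h3 : ∑ p, ∑ q, ∑ r, c p q r * D p q = ∑ p, ∑ q, ∑ r, c p q r * D q r := by
    rw [cyc fun p q r => c p q r * D p q]
    exact Finset.sum_congr rfl fun p _ => Finset.sum_congr rfl fun q _ =>
      Finset.sum_congr rfl fun r _ => by rw [hrot]
  have h4 : ∑ p, ∑ q, ∑ r, c p q r * D p q = ∑ p, ∑ q, ∑ r, c p q r * D r p := by
    rw [h3, cyc fun p q r => c p q r * D q r]
    exact Finset.sum_congr rfl fun p _ => Finset.sum_congr rfl fun q _ =>
      Finset.sum_congr rfl fun r _ => by rw [hrot]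
  -- The factor 6 is 2 from symmetrizing pairs times 3 from the cyclic shifts of a triple.
  calc _ = 3 * (Δ.perimeter * (2 * ∑ p, v p * Δ.rhoDeriv a v p)) := by ring
    _ = ∑ p, ∑ q, ∑ r, c p q r * D p q + ∑ p, ∑ q, ∑ r, c p q r * D q r +
        ∑ p, ∑ q, ∑ r, c p q r * D r p := by rw [h1, h2, ← h3, ← h4]; ring
    _ = _ := by simp only [← Finset.sum_add_distrib, ← mul_add, D, c]

/-- The numerator is the square of the determinant with rows `1`, `(a, b, c)` and `(x, y, z)`; it
vanishes exactly when the values are affine in the points. -/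
lemma sum_sq_div_eq {a b c x y z : ℝ} (h : vander a b c ≠ 0) :
    (y - x) ^ 2 / (b - a) + (z - y) ^ 2 / (c - b) + (x - z) ^ 2 / (a - c) =
      (x * (c - b) + y * (a - c) + z * (b - a)) ^ 2 / vander a b c := by
  have h1 : b - a ≠ 0 := by rintro h0; simp [vander, h0] at h
  have h2 : c - b ≠ 0 := by rintro h0; simp [vander, h0] at h
  have h3 : a - c ≠ 0 := by
    rintro h0; rw [← neg_sub, neg_eq_zero] at h0; simp [vander, h0] at h
  rw [eq_div_iff h, vander]
  field_simp
  ring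

/-- With area `c`, determinant `N` and Vandermonde product `V`, the term is `c * V * (N / V) ^ 2`,
and `c * V > 0`. If two sides coincide, then `c = 0`, which also covers coinciding roots. -/
lemma quadratic_term_pos {a : Δ.RootIndex → ℝ} (ha : Δ.SideOrdered a) (v : Δ.RootIndex → ℝ)
    (p q r : Δ.RootIndex) :
    0 ≤ directionArea (Δ.normalR p.1) (Δ.normalR q.1) (Δ.normalR r.1) *
          ((v q - v p) ^ 2 / (a q - a p) + (v r - v q) ^ 2 / (a r - a q) +
            (v p - v r) ^ 2 / (a p - a r)) ∧
    (p.1 ≠ q.1 → q.1 ≠ r.1 → p.1 ≠ r.1 →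
      v p * (a r - a q) + v q * (a p - a r) + v r * (a q - a p) ≠ 0 →
      0 < directionArea (Δ.normalR p.1) (Δ.normalR q.1) (Δ.normalR r.1) *
          ((v q - v p) ^ 2 / (a q - a p) + (v r - v q) ^ 2 / (a r - a q) +
            (v p - v r) ^ 2 / (a p - a r))) := by
  by_cases h : p.1 ≠ q.1 ∧ q.1 ≠ r.1 ∧ p.1 ≠ r.1
  · have hc := Δ.directionArea_mul_vander_pos ha h.1 h.2.1 h.2.2
    have hv := right_ne_zero_of_mul hc.ne'
    have e : ∀ c N V : ℝ, V ≠ 0 → c * (N ^ 2 / V) = c * V * (N / V) ^ 2 := by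
      intro c N V hV
      field_simp
    rw [sum_sq_div_eq hv, e _ _ _ hv]
    exact ⟨mul_nonneg hc.le (sq_nonneg _), fun _ _ _ hN =>
      mul_pos hc (sq_pos_of_ne_zero (div_ne_zero hN hv))⟩
  · rw [Δ.directionArea_eq_zero (by tauto), zero_mul]
    exact ⟨le_rfl, fun h1 h2 h3 => absurd ⟨h1, h2, h3⟩ h⟩

/-- The first root of a side. -/
def root (i : Fin m) : Δ.RootIndex := ⟨i, 0, Δ.len_pos i⟩

/-- The first side of the polygon. -/
def firstSide : Fin m := ⟨0, by have := Δ.three_le; omega⟩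

/-- The last side of the polygon. -/
def lastSide : Fin m := ⟨m - 1, by have := Δ.three_le; omega⟩

/-- The second side of the polygon. -/
def secondSide : Fin m := ⟨1, by have := Δ.three_le; omega⟩

lemma side_lt : Δ.firstSide < Δ.secondSide ∧ Δ.secondSide < Δ.lastSide := by
  have := Δ.three_le
  simp only [Fin.lt_def, firstSide, secondSide, lastSide]
  omega

lemma perimeter_pos : 0 < Δ.perimeter := by
  refine Δ.perimeter_nonneg.lt_of_ne fun h => ?_
  have h0 := Δ.directionArea_normalR_pos Δ.side_lt.1 Δ.side_lt.2
  have h1 : ∀ p : Δ.RootIndex, euclidLength (Δ.normalR p.1) = 0 := fun p =>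
    (Finset.sum_eq_zero_iff_of_nonneg fun _ _ => euclidLength_nonneg _).1 h.symm p
      (Finset.mem_univ p)
  have e : ∀ i, euclidLength (Δ.normalR i) = 0 := fun i => h1 (Δ.root i)
  simp [directionArea, e] at h0

lemma quadratic_nonneg {a : Δ.RootIndex → ℝ} (ha : Δ.SideOrdered a) (v : Δ.RootIndex → ℝ) :
    0 ≤ ∑ p, v p * Δ.rhoDeriv a v p := by
  have h := Δ.six_perimeter_mul_quadratic a v
  have h1 : 0 ≤ 6 * Δ.perimeter * ∑ p, v p * Δ.rhoDeriv a v p := by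
    rw [h]
    exact Finset.sum_nonneg fun p _ => Finset.sum_nonneg fun q _ => Finset.sum_nonneg fun r _ =>
      (Δ.quadratic_term_pos ha v p q r).1
  exact nonneg_of_mul_nonneg_right h1 (mul_pos (by norm_num) Δ.perimeter_pos)

/-- The quadratic form vanishes only on affine functions of the roots. -/
lemma exists_affine_of_quadratic_eq_zero {a : Δ.RootIndex → ℝ} (ha : Δ.SideOrdered a)
    {v : Δ.RootIndex → ℝ} (h0 : ∑ p, v p * Δ.rhoDeriv a v p = 0) :
    ∃ α β : ℝ, ∀ p, v p = α + β * a p := by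
  have h := Δ.six_perimeter_mul_quadratic a v
  rw [h0, mul_zero] at h
  have key : ∀ p q r : Δ.RootIndex, p.1 ≠ q.1 → q.1 ≠ r.1 → p.1 ≠ r.1 →
      v p * (a r - a q) + v q * (a p - a r) + v r * (a q - a p) = 0 := by
    intro p q r h1 h2 h3
    by_contra hN
    refine ((Δ.quadratic_term_pos ha v p q r).2 h1 h2 h3 hN).ne' ?_
    have hn := fun p q r => (Δ.quadratic_term_pos ha v p q r).1
    have s1 := (Finset.sum_eq_zero_iff_of_nonneg fun p _ => Finset.sum_nonneg fun q _ =>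
      Finset.sum_nonneg fun r _ => hn p q r).1 h.symm p (Finset.mem_univ p)
    have s2 := (Finset.sum_eq_zero_iff_of_nonneg fun q _ =>
      Finset.sum_nonneg fun r _ => hn p q r).1 s1 q (Finset.mem_univ q)
    exact (Finset.sum_eq_zero_iff_of_nonneg fun r _ => hn p q r).1 s2 r (Finset.mem_univ r)
  obtain ⟨l1, l2⟩ := Δ.side_lt
  set x := Δ.root Δ.firstSide
  set y := Δ.root Δ.secondSide
  set z := Δ.root Δ.lastSide
  have hxy : a x < a y := ha x y l1
  have hyz : a y < a z := ha y z l2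
  -- The affine function interpolates `v` at the first roots of the first two sides.
  set β := (v y - v x) / (a y - a x) with hβ
  have eβ : β * (a y - a x) = v y - v x := div_mul_cancel₀ _ (sub_pos.2 hxy).ne'
  -- a relation with two affine values at distinct points determines the third value
  have third : ∀ p q r : Δ.RootIndex, p.1 ≠ q.1 → q.1 ≠ r.1 → p.1 ≠ r.1 → a q ≠ a r →
      v q = v x - β * a x + β * a q → v r = v x - β * a x + β * a r →
      v p = v x - β * a x + β * a p := by
    intro p q r h1 h2 h3 hne hq hr
    have := key p q r h1 h2 h3
    rw [hq, hr] at this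
    apply mul_right_cancel₀ (sub_ne_zero.2 hne.symm)
    linear_combination this
  have vx : v x = v x - β * a x + β * a x := by ring
  have vy : v y = v x - β * a x + β * a y := by linear_combination -eβ
  have other : ∀ p : Δ.RootIndex, p.1 ≠ x.1 → p.1 ≠ y.1 → v p = v x - β * a x + β * a p :=
    fun p h1 h2 => third p x y h1 l1.ne h2 hxy.ne vx vy
  have vz := other z (l1.trans l2).ne' l2.ne'
  refine ⟨v x - β * a x, β, fun p => ?_⟩
  -- A determinant relation needs three distinct sides, so on the first two sides `z` replaces the
  -- reference root of the same side.
  by_cases h1 : p.1 = x.1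
  · exact third p y z (by rw [h1]; exact l1.ne) l2.ne (by rw [h1]; exact (l1.trans l2).ne)
      hyz.ne vy vz
  · by_cases h2 : p.1 = y.1
    · exact third p x z h1 (l1.trans l2).ne (by rw [h2]; exact l2.ne) (hxy.trans hyz).ne vx vz
    · exact other p h1 h2

/-! ### Moments and normalization by Möbius transformations -/

/-- The moment of the roots about an extremal side is negative. -/
lemma moment_neg {a : Δ.RootIndex → ℝ} (ha : Δ.SideOrdered a) {i : Fin m}
    (hi : i = Δ.firstSide ∨ i = Δ.lastSide) :
    ∑ q : Δ.RootIndex, a q * wedge (Δ.normalR i) (Δ.normalR q.1) < 0 := by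
  set u := Δ.normalR i
  set p := Δ.root i
  have e1 : Δ.perimeter * ∑ q : Δ.RootIndex, a q * wedge u (Δ.normalR q.1) =
      ∑ q : Δ.RootIndex, ∑ r : Δ.RootIndex,
        a q * directionArea u (Δ.normalR q.1) (Δ.normalR r.1) := by
    simp only [← Finset.mul_sum, Δ.sum_directionArea]
    rw [Finset.mul_sum]
    exact Finset.sum_congr rfl fun q _ => by ring
  -- Antisymmetrization in `q` and `r`: only root differences remain, which can be compared with the
  -- areas.
  have e2 : 2 * (Δ.perimeter * ∑ q : Δ.RootIndex, a q * wedge u (Δ.normalR q.1)) =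
      ∑ q : Δ.RootIndex, ∑ r : Δ.RootIndex,
        (a q - a r) * directionArea u (Δ.normalR q.1) (Δ.normalR r.1) := by
    rw [two_mul]
    nth_rewrite 1 [e1]
    rw [e1.trans Finset.sum_comm, ← Finset.sum_add_distrib]
    refine Finset.sum_congr rfl fun q _ => ?_
    rw [← Finset.sum_add_distrib]
    refine Finset.sum_congr rfl fun r _ => ?_
    rw [directionArea_swap u (Δ.normalR q.1)]
    ring
  have sgn : ∀ q : Δ.RootIndex, q.1 ≠ i → ∀ r : Δ.RootIndex, r.1 ≠ i →
      0 < (a q - a p) * (a r - a p) := by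
    intro q hq r hr
    rcases hi with rfl | rfl
    · have hl : ∀ s : Δ.RootIndex, s.1 ≠ Δ.firstSide → a p < a s := fun s hs =>
        ha p s (lt_of_le_of_ne (Fin.le_def.2 (Nat.zero_le _)) (Ne.symm hs))
      exact mul_pos (sub_pos.2 (hl q hq)) (sub_pos.2 (hl r hr))
    · have hl : ∀ s : Δ.RootIndex, s.1 ≠ Δ.lastSide → a s < a p := fun s hs =>
        ha s p (lt_of_le_of_ne (Fin.le_def.2 (Nat.le_sub_one_of_lt s.1.2)) hs)
      exact mul_pos_of_neg_of_neg (sub_neg.2 (hl q hq)) (sub_neg.2 (hl r hr))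
  have strict : ∀ q r : Δ.RootIndex, p.1 ≠ q.1 → q.1 ≠ r.1 → p.1 ≠ r.1 →
      (a q - a r) * directionArea u (Δ.normalR q.1) (Δ.normalR r.1) < 0 := by
    intro q r h1 h2 h3
    have := Δ.directionArea_mul_vander_pos ha h1 h2 h3
    -- Side `i` is extremal, so the other roots lie on one side of `a p`, and the Vandermonde sign
    -- is that of `a r - a q`.
    have h4 := sgn q h1.symm r h3.symm
    change 0 < directionArea u _ _ * ((a q - a p) * (a r - a q) * (a r - a p)) at this
    have h5 : 0 < (directionArea u (Δ.normalR q.1) (Δ.normalR r.1) * (a r - a q)) *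
      ((a q - a p) * (a r - a p)) := by convert this using 1; ring
    have := (pos_iff_pos_of_mul_pos h5).2 h4
    linarith
  have weak : ∀ q r : Δ.RootIndex,
      (a q - a r) * directionArea u (Δ.normalR q.1) (Δ.normalR r.1) ≤ 0 := by
    intro q r
    by_cases h : p.1 ≠ q.1 ∧ q.1 ≠ r.1 ∧ p.1 ≠ r.1
    · exact (strict q r h.1 h.2.1 h.2.2).le
    · have := Δ.directionArea_eq_zero (p := p) (q := q) (r := r) (by tauto)
      exact le_of_eq (mul_eq_zero_of_right _ this)
  obtain ⟨q, r, h1, h2, h3⟩ : ∃ q r : Δ.RootIndex, p.1 ≠ q.1 ∧ q.1 ≠ r.1 ∧ p.1 ≠ r.1 := by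
    obtain ⟨l1, l2⟩ := Δ.side_lt
    rcases hi with rfl | rfl
    · exact ⟨Δ.root Δ.secondSide, Δ.root Δ.lastSide, l1.ne, l2.ne, (l1.trans l2).ne⟩
    · exact ⟨Δ.root Δ.firstSide, Δ.root Δ.secondSide, (l1.trans l2).ne', l1.ne, l2.ne'⟩
  have neg : ∑ q : Δ.RootIndex, ∑ r : Δ.RootIndex,
        (a q - a r) * directionArea u (Δ.normalR q.1) (Δ.normalR r.1) < 0 :=
    Finset.sum_neg' (fun q _ => Finset.sum_nonpos fun r _ => weak q r)
      ⟨q, Finset.mem_univ _, Finset.sum_neg' (fun r _ => weak q r)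
        ⟨r, Finset.mem_univ _, strict q r h1 h2 h3⟩⟩
  rw [← e2] at neg
  have hP := Δ.perimeter_pos
  by_contra! hc
  have := mul_nonneg hP.le hc
  linarith

/-- A Möbius transformation that is increasing on an interval containing the roots preserves the
order of the roots. -/
lemma exists_lexOrdered_mobius (a : Δ.rootSet) (ha : Δ.LexOrdered a) {α β γ δ : ℝ}
    (hdet : 0 < α * δ - β * γ) (hden : ∀ p, 0 < γ * a.1 p + δ) :
    ∃ b : Δ.rootSet, Δ.LexOrdered b ∧ Δ.rootClass b = Δ.rootClass a ∧
      ∀ p, b.1 p = (α * a.1 p + β) / (γ * a.1 p + δ) := by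
  set b : Δ.RootIndex → ℝ := fun p => (α * a.1 p + β) / (γ * a.1 p + δ) with hb
  have hsub : ∀ p q, b q - b p =
      (α * δ - β * γ) * (a.1 q - a.1 p) / ((γ * a.1 q + δ) * (γ * a.1 p + δ)) := by
    intro p q
    rw [hb, div_sub_div _ _ (hden q).ne' (hden p).ne']
    congr 1
    ring
  have hlex : Δ.LexOrdered b := by
    refine ⟨fun i j j' h => ?_, fun i i' h j j' => ?_⟩
    · rw [← sub_nonneg, hsub]
      exact div_nonneg (mul_nonneg hdet.le (sub_nonneg.2 (ha.1 i j j' h)))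
        (mul_pos (hden _) (hden _)).le
    · rw [← sub_pos, hsub]
      exact div_pos (mul_pos hdet (sub_pos.2 (ha.2 i i' h j j'))) (mul_pos (hden _) (hden _))
  refine ⟨⟨b, hlex.sideOrdered.mem_rootSet⟩, hlex, (Quotient.sound ?_).symm, fun p => rfl⟩
  refine ⟨Matrix.GeneralLinearGroup.mkOfDetNeZero !![α, β; γ, δ]
    (by rw [Matrix.det_fin_two_of]; exact hdet.ne'), fun p => ?_⟩
  rw [OnePoint.smul_some_eq_ite]
  simp [Matrix.GeneralLinearGroup.mkOfDetNeZero, (hden p).ne', hb]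

/-- The moment of the roots about the `i`-th side. -/
def moment (i : Fin m) (a : Δ.RootIndex → ℝ) : ℝ :=
  ∑ q : Δ.RootIndex, a q * wedge (Δ.normalR i) (Δ.normalR q.1)

lemma wedge_last_first_pos :
    0 < wedge (Δ.normalR Δ.lastSide) (Δ.normalR Δ.firstSide) := by
  rw [wedge_normalR_pos_iff]
  have h := Δ.wedge_side_rotate_pos Δ.lastSide
  have h3 := Δ.three_le
  have e : finRotate m Δ.lastSide = Δ.firstSide :=
    Fin.ext (finRotate_val_of_eq (by simp only [lastSide]; omega))
  rwa [e] at h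

/-- A Möbius transformation makes the moments about the first and the last side equal. -/
lemma exists_moment_eq (a : Δ.rootSet) (ha : Δ.LexOrdered a) :
    ∃ b : Δ.rootSet, Δ.LexOrdered b ∧ Δ.rootClass b = Δ.rootClass a ∧
      Δ.moment Δ.firstSide b.1 = Δ.moment Δ.lastSide b.1 := by
  classical
  have : Nonempty Δ.RootIndex := ⟨Δ.root Δ.firstSide⟩
  have hso := ha.sideOrdered
  obtain ⟨pmin, hmin⟩ := Finite.exists_min a.1
  obtain ⟨pmax, hmax⟩ := Finite.exists_max a.1
  set lo := a.1 pmin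
  set hi := a.1 pmax
  have hlt : lo < hi := (hmin (Δ.root Δ.firstSide)).trans_lt
    ((hso (Δ.root Δ.firstSide) (Δ.root Δ.secondSide) Δ.side_lt.1).trans_le (hmax _))
  have first : ∀ p, a.1 p = lo → p.1 = Δ.firstSide := by
    intro p hp
    by_contra h
    have := hso (Δ.root Δ.firstSide) p
      (lt_of_le_of_ne (Fin.le_def.2 (Nat.zero_le _)) (Ne.symm h))
    linarith [hmin (Δ.root Δ.firstSide)]
  have last : ∀ p, a.1 p = hi → p.1 = Δ.lastSide := by
    intro p hp
    by_contra h
    have := hso p (Δ.root Δ.lastSide) (lt_of_le_of_ne (Fin.le_def.2 (Nat.le_sub_one_of_lt p.1.2)) h)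
    linarith [hmax (Δ.root Δ.lastSide)]
  -- Pairing with `w` gives the difference of the two moments. At the extremal roots `w` is positive
  -- because the last and the first side are consecutive.
  set w : Δ.RootIndex → ℝ := fun p => wedge (Δ.normalR Δ.lastSide) (Δ.normalR p.1) -
    wedge (Δ.normalR Δ.firstSide) (Δ.normalR p.1) with hw
  have hwsum : ∑ p, w p = 0 := by
    simp only [hw, Finset.sum_sub_distrib, sum_wedge_normalR, sub_zero]
  have wfirst : ∀ p, a.1 p = lo → 0 < w p := by
    intro p hp
    have h1 := Δ.wedge_last_first_pos
    have h2 : wedge (Δ.normalR Δ.firstSide) (Δ.normalR Δ.firstSide) = 0 :=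
      Δ.wedge_normalR_eq_zero (p := Δ.root Δ.firstSide) (q := Δ.root Δ.firstSide) rfl
    simp only [hw, first p hp, h2]
    linarith
  have wlast : ∀ p, a.1 p = hi → 0 < w p := by
    intro p hp
    have h1 := Δ.wedge_last_first_pos
    have h2 : wedge (Δ.normalR Δ.lastSide) (Δ.normalR Δ.lastSide) = 0 :=
      Δ.wedge_normalR_eq_zero (p := Δ.root Δ.lastSide) (q := Δ.root Δ.lastSide) rfl
    rw [wedge_comm_neg] at h1
    simp only [hw, last p hp, h2]
    linarith
  -- Möbius maps sending `lo` to 0 and `hi` to 1. At `κ = 0` all roots except the minimal ones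
  -- collapse to 1, at `κ = 1` all except the maximal ones to 0. The separate values at `lo` and
  -- `hi` keep `T` continuous at these ends, where the fraction would be `0 / 0`.
  set T : Δ.RootIndex → ℝ → ℝ := fun p κ => if a.1 p = lo then 0 else if a.1 p = hi then 1 else
    (1 - κ) * (a.1 p - lo) / (κ * (hi - a.1 p) + (1 - κ) * (a.1 p - lo)) with hT
  have dpos : ∀ p, a.1 p ≠ lo → a.1 p ≠ hi → ∀ κ ∈ Set.Icc (0 : ℝ) 1,
      0 < κ * (hi - a.1 p) + (1 - κ) * (a.1 p - lo) := by
    intro p h1 h2 κ hκ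
    have h3 : 0 < a.1 p - lo := sub_pos.2 ((hmin p).lt_of_ne (Ne.symm h1))
    have h4 : 0 < hi - a.1 p := sub_pos.2 ((hmax p).lt_of_ne h2)
    rcases hκ.1.eq_or_lt with h | h
    · rw [← h]; linarith
    · have := mul_pos h h4
      have := mul_nonneg (sub_nonneg.2 hκ.2) h3.le
      linarith
  have cont : ContinuousOn (fun κ => ∑ p, w p * T p κ) (Set.Icc 0 1) := by
    refine continuousOn_finsetSum _ fun p _ => continuousOn_const.mul ?_
    by_cases h1 : a.1 p = lo
    · simp only [hT, h1, if_true]; exact continuousOn_const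
    by_cases h2 : a.1 p = hi
    · simp only [hT, if_neg h1, if_pos h2]; exact continuousOn_const
    simp only [hT, if_neg h1, if_neg h2]
    exact ContinuousOn.div (by fun_prop) (by fun_prop) fun κ hκ => (dpos p h1 h2 κ hκ).ne'
  -- Since `w` has sum zero, the value is minus the total weight of the minimal roots.
  have h0 : ∑ p, w p * T p 0 < 0 := by
    have e : ∑ p, w p * T p 0 = ∑ p, w p * (T p 0 - 1) := by
      simp only [mul_sub, mul_one, Finset.sum_sub_distrib, hwsum, sub_zero]
    rw [e]
    refine Finset.sum_neg' (fun p _ => ?_) ⟨pmin, Finset.mem_univ _, ?_⟩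
    · by_cases h1 : a.1 p = lo
      · have := wfirst p h1
        simp only [hT, h1, if_true]
        linarith
      · by_cases h2 : a.1 p = hi
        · simp [hT, h2, hlt.ne']
        · simp [hT, h1, h2, sub_ne_zero.2 h1]
    · have := wfirst pmin rfl
      have e1 : a.1 pmin = lo := rfl
      simp only [hT, e1, if_true]
      linarith
  have h1 : 0 < ∑ p, w p * T p 1 := by
    refine Finset.sum_pos' (fun p _ => ?_) ⟨pmax, Finset.mem_univ _, ?_⟩
    · by_cases h1 : a.1 p = lo
      · simp [hT, h1]
      · by_cases h2 : a.1 p = hi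
        · have := wlast p h2
          simpa [hT, h1, h2, hlt.ne'] using this.le
        · simp [hT, h1, h2]
    · have := wlast pmax rfl
      have e1 : a.1 pmax = hi := rfl
      simpa [hT, e1, hlt.ne'] using this
  obtain ⟨κ, hκ, hz⟩ := intermediate_value_Icc zero_le_one cont ⟨h0.le, h1.le⟩
  simp only at hz
  have k0 : 0 < κ := hκ.1.lt_of_ne (by rintro rfl; exact h0.ne hz)
  have k1 : 0 < 1 - κ := sub_pos.2 (hκ.2.lt_of_ne (by rintro rfl; exact h1.ne' hz))
  have dpos' : ∀ p, 0 < κ * (hi - a.1 p) + (1 - κ) * (a.1 p - lo) := by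
    intro p
    by_cases h1 : a.1 p = lo
    · rw [h1, sub_self, mul_zero, add_zero]
      exact mul_pos k0 (sub_pos.2 hlt)
    by_cases h2 : a.1 p = hi
    · rw [h2, sub_self, mul_zero, zero_add]
      exact mul_pos k1 (sub_pos.2 hlt)
    exact dpos p h1 h2 κ hκ
  have Teq : ∀ p, T p κ =
      (1 - κ) * ((a.1 p - lo) / (κ * (hi - a.1 p) + (1 - κ) * (a.1 p - lo))) := by
    intro p
    by_cases h1 : a.1 p = lo
    · simp [hT, h1]
    by_cases h2 : a.1 p = hi
    · have := sub_ne_zero.2 hlt.ne'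
      simp only [hT, h2, if_neg hlt.ne', if_true, sub_self, mul_zero, zero_add]
      field_simp
    · simp only [hT, if_neg h1, if_neg h2, mul_div_assoc]
  -- This is `T` without the factor `1 - κ`, which is irrelevant to a homogeneous condition; the
  -- determinant is `κ * (hi - lo)`.
  obtain ⟨b, hb, hcl, hbe⟩ := Δ.exists_lexOrdered_mobius a ha (α := 1) (β := -lo)
    (γ := 1 - 2 * κ) (δ := κ * hi - (1 - κ) * lo)
    (by have := mul_pos k0 (sub_pos.2 hlt); linarith)
    (fun p => by have := dpos' p; linarith)
  refine ⟨b, hb, hcl, ?_⟩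
  have e : Δ.moment Δ.lastSide b.1 - Δ.moment Δ.firstSide b.1 = ∑ p, w p * b.1 p := by
    simp only [moment, ← Finset.sum_sub_distrib, hw]
    exact Finset.sum_congr rfl fun p _ => by ring
  have e2 : (1 - κ) * ∑ p, w p * b.1 p = 0 := by
    rw [← hz, Finset.mul_sum]
    refine Finset.sum_congr rfl fun p _ => ?_
    have e3 : (1 - 2 * κ) * a.1 p + (κ * hi - (1 - κ) * lo) =
      κ * (hi - a.1 p) + (1 - κ) * (a.1 p - lo) := by ring
    rw [Teq, hbe, e3, one_mul, ← sub_eq_add_neg]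
    ring
  rw [(mul_eq_zero.1 e2).resolve_left k1.ne'] at e
  linarith

/-- Every class of ordered roots has a normalized representative. -/
lemma exists_normalized (a : Δ.rootSet) (ha : Δ.LexOrdered a) :
    ∃ b : Δ.rootSet, Δ.LexOrdered b ∧ Δ.rootClass b = Δ.rootClass a ∧
      ∑ p, b.1 p = 0 ∧ Δ.moment Δ.firstSide b.1 = -1 ∧ Δ.moment Δ.lastSide b.1 = -1 := by
  have : Nonempty Δ.RootIndex := ⟨Δ.root Δ.firstSide⟩
  obtain ⟨b, hb, hcl, hbm⟩ := Δ.exists_moment_eq a ha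
  have hneg : Δ.moment Δ.firstSide b.1 < 0 := Δ.moment_neg hb.sideOrdered (Or.inl rfl)
  -- By balancing, `x ↦ s * x + t` multiplies every moment by `s`. Negativity of the common moment
  -- makes `s` positive, so order is kept; `t` then centres the roots.
  set s := -(Δ.moment Δ.firstSide b.1)⁻¹ with hs
  have hspos : 0 < s := neg_pos.2 (inv_lt_zero.2 hneg)
  set t := -(s * ∑ p, b.1 p) / (Fintype.card Δ.RootIndex : ℝ) with ht
  obtain ⟨c, hc, hcl', hce⟩ := Δ.exists_lexOrdered_mobius b hb (α := s) (β := t)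
    (γ := 0) (δ := 1) (by simpa using hspos) (by simp)
  have hce' : ∀ p, c.1 p = s * b.1 p + t := fun p => by rw [hce]; simp
  have hm : ∀ i, Δ.moment i c.1 = s * Δ.moment i b.1 := by
    intro i
    simp only [moment, hce', add_mul, Finset.sum_add_distrib, ← Finset.mul_sum,
      sum_wedge_normalR, mul_zero, add_zero, mul_assoc]
  have hs1 : s * Δ.moment Δ.firstSide b.1 = -1 := by
    rw [hs, neg_mul, inv_mul_cancel₀ hneg.ne]
  refine ⟨c, hc, hcl'.trans hcl, ?_, by rw [hm, hs1], by rw [hm, ← hbm, hs1]⟩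
  simp only [hce', Finset.sum_add_distrib, ← Finset.mul_sum, Finset.sum_const, Finset.card_univ,
    nsmul_eq_mul, ht]
  rw [mul_div_cancel₀ _ (Nat.cast_ne_zero.2 Fintype.card_ne_zero)]
  ring

end LatticePolygon

/-! ### Maps that are monotone along a subspace -/

section MonotoneMap

variable {E : Type*} [NormedAddCommGroup E] [InnerProductSpace ℝ E]
  {L : Submodule ℝ E} {C : Set E} {F : E → E} {J : E → E →L[ℝ] E}

/-- A map whose derivative is positive definite along `L` is injective along `L`, even modulo the
orthogonal complement of `L`. -/
lemma eq_of_sub_mem_orthogonal (hconv : Convex ℝ C) (hF : ∀ a ∈ C, HasFDerivAt F (J a) a)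
    (hpos : ∀ a ∈ C, ∀ v ∈ L, v ≠ 0 → 0 < inner ℝ v (J a v)) {a b : E} (ha : a ∈ C) (hb : b ∈ C)
    (hab : a - b ∈ L) (h : F a - F b ∈ Lᗮ) : a = b := by
  by_contra hne
  set v := a - b with hv
  have hv0 : v ≠ 0 := sub_ne_zero.2 hne
  have hmem : ∀ t ∈ Set.Icc (0 : ℝ) 1, b + t • v ∈ C := fun t ht =>
    hconv.add_smul_sub_mem hb ha ht
  -- The pairing of `v` with `F` strictly increases along the segment from `b` to `a`, yet its end
  -- values agree because `F a - F b` is orthogonal to `v`.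
  have hd : ∀ t ∈ Set.Icc (0 : ℝ) 1,
      HasDerivAt (fun s : ℝ => inner ℝ v (F (b + s • v))) (inner ℝ v (J (b + t • v) v)) t := by
    intro t ht
    have h1 : HasDerivAt (fun s : ℝ => b + s • v) v t := by
      simpa using ((hasDerivAt_id t).smul_const v).const_add b
    have h2 := (hF _ (hmem t ht)).comp_hasDerivAt t h1
    simpa using (hasDerivAt_const t v).inner ℝ h2
  have hmono := strictMonoOn_of_deriv_pos (convex_Icc (0 : ℝ) 1)
    (fun t ht => (hd t ht).continuousAt.continuousWithinAt)
    (fun t ht => by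
      have ht' := interior_subset ht
      rw [(hd t ht').deriv]
      exact hpos _ (hmem t ht') v hab hv0)
  have h01 := hmono (Set.left_mem_Icc.2 zero_le_one) (Set.right_mem_Icc.2 zero_le_one) one_pos
  have e : b + v = a := by rw [hv]; abel
  simp only [zero_smul, add_zero, one_smul, e] at h01
  have h2 := (Submodule.mem_orthogonal L _).1 h v hab
  rw [inner_sub_right] at h2
  linarith

/-- A smooth map whose derivative is positive definite along `L` has a smooth local inverse along
`L`, which depends only on values modulo the orthogonal complement of `L`. -/
lemma exists_smooth_inverse [FiniteDimensional ℝ E] (hC : IsOpen C) (hconv : Convex ℝ C)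
    (hF : ∀ a ∈ C, HasFDerivAt F (J a) a) (hsm : ContDiffOn ℝ ∞ F C)
    (hpos : ∀ a ∈ C, ∀ v ∈ L, v ≠ 0 → 0 < inner ℝ v (J a v)) {a : E} (ha : a ∈ C) :
    ∃ U : Set E, IsOpen U ∧ (∀ z, z - F a ∈ Lᗮ → z ∈ U) ∧ ∃ f : E → E, ContDiffOn ℝ ∞ f U ∧
      ∀ z ∈ U, ∀ b ∈ C, b - a ∈ L → z - F b ∈ Lᗮ → f z = b := by
  set P : E →L[ℝ] E := L.starProjection with hP
  have PL : ∀ v ∈ L, P v = v := fun v hv => Submodule.starProjection_eq_self_iff.2 hv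
  have Pmem : ∀ v, P v ∈ L := fun v => Submodule.starProjection_apply_mem _ _
  have PP : ∀ v, P (P v) = P v := fun v => PL _ (Pmem v)
  have Pzero : ∀ v, P v = 0 ↔ v ∈ Lᗮ := fun v => L.starProjection_apply_eq_zero_iff
  -- `Ψ` records the `L`-part of the value and the `Lᗮ`-part of the point, turning inversion along
  -- `L` into an ordinary inverse function problem.
  set Ψ : E → E := fun x => P (F x) + (x - P x) with hΨ
  set D : E → E →L[ℝ] E := fun x => P.comp (J x) + (ContinuousLinearMap.id ℝ E - P) with hD
  have hΨd : ∀ x ∈ C, HasFDerivAt Ψ (D x) x := fun x hx =>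
    (P.hasFDerivAt.comp x (hF x hx)).add ((hasFDerivAt_id x).sub P.hasFDerivAt)
  have hΨs : ContDiffOn ℝ ∞ Ψ C :=
    (P.contDiff.comp_contDiffOn hsm).add (contDiffOn_id.sub P.contDiff.contDiffOn)
  have hinj : ∀ x ∈ C, Function.Injective (D x) := by
    intro x hx
    rw [injective_iff_map_eq_zero]
    intro v hv
    have hv' : P (J x v) + (v - P v) = 0 := hv
    have h1 : P (J x v) = 0 := by simpa [PP] using congrArg P hv'
    rw [h1, zero_add, sub_eq_zero] at hv'
    have hvL : v ∈ L := hv' ▸ Pmem v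
    by_contra h0
    exact (hpos x hx v hvL h0).ne' ((Submodule.mem_orthogonal L _).1 ((Pzero _).1 h1) v hvL)
  have hequiv : ∀ x ∈ C, ∃ e : E ≃L[ℝ] E, (e : E →L[ℝ] E) = D x := fun x hx =>
    ⟨(LinearEquiv.ofInjectiveEndo (D x).toLinearMap (hinj x hx)).toContinuousLinearEquiv,
      by ext v; rfl⟩
  obtain ⟨e, he⟩ := hequiv a ha
  have hea : HasFDerivAt Ψ (e : E →L[ℝ] E) a := he ▸ hΨd a ha
  have hca : ContDiffAt ℝ ∞ Ψ a := hΨs.contDiffAt (hC.mem_nhds ha)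
  set Φ := hca.toOpenPartialHomeomorph Ψ hea (by simp) with hΦ
  have hΦc : (Φ : E → E) = Ψ := rfl
  have haΦ : a ∈ Φ.source := hca.mem_toOpenPartialHomeomorph_source hea (by simp)
  -- Where the inverse lands in `C`, the derivative of `Ψ` is invertible, so the inverse is smooth
  -- on all of `W`.
  set W : Set E := Φ.target ∩ Φ.symm ⁻¹' C with hW
  have hWo : IsOpen W := Φ.symm.isOpen_inter_preimage hC
  have hWs : ContDiffOn ℝ ∞ Φ.symm W := by
    intro w hw
    obtain ⟨e', he'⟩ := hequiv _ hw.2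
    refine (Φ.contDiffAt_symm (f₀' := e') hw.1 ?_ ?_).contDiffWithinAt
    · rw [he', hΦc]; exact hΨd _ hw.2
    · rw [hΦc]; exact hΨs.contDiffAt (hC.mem_nhds hw.2)
  set T : E → E := fun z => P z + (a - P a) with hT
  have hTs : ContDiff ℝ ∞ T := P.contDiff.add contDiff_const
  refine ⟨T ⁻¹' W, hWo.preimage hTs.continuous, fun z hz => ?_, Φ.symm ∘ T,
    hWs.comp hTs.contDiffOn (Set.mapsTo_preimage _ _), fun z hz b hb hba hzb => ?_⟩
  · have e1 : T z = Φ a := by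
      have := (Pzero _).2 hz
      rw [map_sub, sub_eq_zero] at this
      simp only [hT, hΦc, hΨ, this]
    rw [Set.mem_preimage, e1]
    refine ⟨Φ.map_source haΦ, ?_⟩
    rw [Set.mem_preimage, Φ.left_inv haΦ]
    exact ha
  · set c := Φ.symm (T z) with hc
    have hcC : c ∈ C := hz.2
    have h1 : Ψ c = T z := Φ.right_inv hz.1
    have h2 : P z = P (F b) := by
      have := (Pzero _).2 hzb
      rwa [map_sub, sub_eq_zero] at this
    have h3 : b - P b = a - P a := by
      have := PL _ hba
      rw [map_sub] at this
      rw [sub_eq_sub_iff_sub_eq_sub, this]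
    have h4 : P (F c) + (c - P c) = P (F b) + (b - P b) := by
      rw [h3, ← h2]; exact h1
    have h5 : P (F c) = P (F b) := by simpa [PP] using congrArg P h4
    rw [h5, add_right_inj, sub_eq_sub_iff_sub_eq_sub] at h4
    change c = b
    refine eq_of_sub_mem_orthogonal hconv hF hpos hcC hb ?_ ((Pzero _).1 ?_)
    · rw [h4]; exact L.sub_mem (Pmem c) (Pmem b)
    · rw [map_sub, h5, sub_self]

end MonotoneMap

/-! ### Positive definiteness along normalized roots -/

namespace LatticePolygon

variable {m : ℕ} (Δ : LatticePolygon m)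

/-- The moment of the roots about the `i`-th side, as a linear map. -/
def momentMap (i : Fin m) : (Δ.RootIndex → ℝ) →ₗ[ℝ] ℝ where
  toFun := Δ.moment i
  map_add' x y := by simp only [moment, Pi.add_apply, add_mul, Finset.sum_add_distrib]
  map_smul' r x := by
    simp only [moment, Pi.smul_apply, smul_eq_mul, mul_assoc, ← Finset.mul_sum, RingHom.id_apply]

lemma momentMap_apply (i : Fin m) (a : Δ.RootIndex → ℝ) :
    Δ.momentMap i a = Δ.moment i a := rfl

/-- The coordinates of the Euclidean space of root parameters. -/
abbrev coords : EuclideanSpace ℝ Δ.RootIndex ≃L[ℝ] (Δ.RootIndex → ℝ) :=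
  EuclideanSpace.equiv Δ.RootIndex ℝ

lemma inner_coords (v w : EuclideanSpace ℝ Δ.RootIndex) :
    inner ℝ v w = ∑ p, Δ.coords v p * Δ.coords w p := by
  rw [PiLp.inner_apply]
  exact Finset.sum_congr rfl fun p _ => mul_comm _ _

/-- The directions along normalized roots. -/
def normalizedDirections : Submodule ℝ (EuclideanSpace ℝ Δ.RootIndex) :=
  (LinearMap.ker (∑ p, LinearMap.proj (R := ℝ) (φ := fun _ : Δ.RootIndex => ℝ) p) ⊓
    LinearMap.ker (Δ.momentMap Δ.firstSide) ⊓ LinearMap.ker (Δ.momentMap Δ.lastSide)).comap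
    Δ.coords.toLinearEquiv.toLinearMap

lemma mem_normalizedDirections (v : EuclideanSpace ℝ Δ.RootIndex) :
    v ∈ Δ.normalizedDirections ↔ ∑ p, Δ.coords v p = 0 ∧
      Δ.moment Δ.firstSide (Δ.coords v) = 0 ∧ Δ.moment Δ.lastSide (Δ.coords v) = 0 := by
  simp [normalizedDirections, momentMap_apply, and_assoc]

/-- The first and last normals span the plane, so pairing with a translation is a combination of the
two moments that vanish on `normalizedDirections`. -/
lemma mem_orthogonal_of_mem_translations {w : EuclideanSpace ℝ Δ.RootIndex}
    (hw : Δ.coords w ∈ Δ.translations) : w ∈ Δ.normalizedDirectionsᗮ := by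
  obtain ⟨x, hx⟩ := hw
  rw [Submodule.mem_orthogonal]
  intro v hv
  obtain ⟨-, h1, h2⟩ := (Δ.mem_normalizedDirections v).1 hv
  rw [inner_coords, ← hx]
  have hD := Δ.wedge_last_first_pos
  set f := Δ.normalR Δ.firstSide with hf
  set l := Δ.normalR Δ.lastSide with hl
  apply mul_left_cancel₀ hD.ne'
  have e : wedge l f * ∑ p, Δ.coords v p * Δ.translationMap x p =
      wedge x f * Δ.moment Δ.lastSide (Δ.coords v) -
        wedge x l * Δ.moment Δ.firstSide (Δ.coords v) := by
    simp only [moment, Finset.mul_sum, ← Finset.sum_sub_distrib]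
    refine Finset.sum_congr rfl fun p _ => ?_
    change _ * (_ * wedge x (Δ.normalR p.1)) = _
    rw [← hf, ← hl]
    simp only [wedge]
    ring
  rw [e, h1, h2]
  ring

/-- The tuples of roots that are ordered by sides, in the Euclidean space of root parameters. -/
def orderedRoots : Set (EuclideanSpace ℝ Δ.RootIndex) := {a | Δ.SideOrdered (Δ.coords a)}

lemma isOpen_orderedRoots : IsOpen Δ.orderedRoots := by
  simp only [orderedRoots, SideOrdered, Set.ofPred_forall]
  refine isOpen_iInter_of_finite fun p => isOpen_iInter_of_finite fun q => ?_
  by_cases h : p.1 < q.1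
  · simp only [h, Set.iInter_true]
    exact isOpen_lt ((continuous_apply p).comp Δ.coords.continuous)
      ((continuous_apply q).comp Δ.coords.continuous)
  · simp [h]

lemma convex_orderedRoots : Convex ℝ Δ.orderedRoots := by
  intro a ha b hb s t hs ht hst p q hpq
  have h1 := ha p q hpq
  have h2 := hb p q hpq
  simp only [map_add, map_smul, Pi.add_apply, Pi.smul_apply, smul_eq_mul]
  rcases hs.eq_or_lt with h | h
  · have : t = 1 := by linarith
    simpa [← h, this] using h2
  · exact add_lt_add_of_lt_of_le (mul_lt_mul_of_pos_left h1 h) (mul_le_mul_of_nonneg_left h2.le ht)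

/-- The tentacle positions as a map of the Euclidean space of root parameters. -/
def rhoE (a : EuclideanSpace ℝ Δ.RootIndex) : EuclideanSpace ℝ Δ.RootIndex :=
  Δ.coords.symm (Δ.rho (Δ.coords a))

/-- The derivative of `rhoE`. -/
def rhoEDeriv (a : EuclideanSpace ℝ Δ.RootIndex) :
    EuclideanSpace ℝ Δ.RootIndex →L[ℝ] EuclideanSpace ℝ Δ.RootIndex :=
  (Δ.coords.symm : (Δ.RootIndex → ℝ) →L[ℝ] EuclideanSpace ℝ Δ.RootIndex).comp
    ((Δ.rhoDeriv (Δ.coords a)).comp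
      (Δ.coords : EuclideanSpace ℝ Δ.RootIndex →L[ℝ] (Δ.RootIndex → ℝ)))

lemma hasFDerivAt_rhoE {a : EuclideanSpace ℝ Δ.RootIndex} (ha : a ∈ Δ.orderedRoots) :
    HasFDerivAt Δ.rhoE (Δ.rhoEDeriv a) a :=
  Δ.coords.symm.hasFDerivAt.comp a
    ((Δ.hasFDerivAt_rho (SideOrdered.mem_rootSet ha)).comp a Δ.coords.hasFDerivAt)

lemma contDiffOn_rhoE : ContDiffOn ℝ ∞ Δ.rhoE Δ.orderedRoots :=
  Δ.coords.symm.contDiff.comp_contDiffOn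
    (Δ.contDiffOn_rho.comp Δ.coords.contDiff.contDiffOn fun _ ha => SideOrdered.mem_rootSet ha)

/-- A null vector is `α + β * a`. Its moment about the first side is `β` times the negative moment
of `a`, so `β = 0`; the vanishing sum then gives `α = 0`. -/
lemma inner_rhoEDeriv_pos {a : EuclideanSpace ℝ Δ.RootIndex} (ha : a ∈ Δ.orderedRoots)
    {v : EuclideanSpace ℝ Δ.RootIndex} (hv : v ∈ Δ.normalizedDirections) (hv0 : v ≠ 0) :
    0 < inner ℝ v (Δ.rhoEDeriv a v) := by
  have e : inner ℝ v (Δ.rhoEDeriv a v) =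
      ∑ p, Δ.coords v p * Δ.rhoDeriv (Δ.coords a) (Δ.coords v) p := by
    rw [inner_coords]
    rfl
  rw [e]
  refine (Δ.quadratic_nonneg ha _).lt_of_ne fun h0 => hv0 ?_
  obtain ⟨α, β, hαβ⟩ := Δ.exists_affine_of_quadratic_eq_zero ha h0.symm
  obtain ⟨h1, h2, -⟩ := (Δ.mem_normalizedDirections v).1 hv
  have hβ : β = 0 := by
    have h3 : β * Δ.moment Δ.firstSide (Δ.coords a) = 0 := by
      rw [← h2]
      simp only [moment, hαβ, add_mul, Finset.sum_add_distrib, ← Finset.mul_sum,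
        sum_wedge_normalR, mul_zero, zero_add, mul_assoc]
    exact (mul_eq_zero.1 h3).resolve_right (Δ.moment_neg ha (Or.inl rfl)).ne
  have : Nonempty Δ.RootIndex := ⟨Δ.root Δ.firstSide⟩
  have hα : α = 0 := by
    simp only [hαβ, hβ, zero_mul, add_zero, Finset.sum_const, Finset.card_univ,
      nsmul_eq_mul] at h1
    exact (mul_eq_zero.1 h1).resolve_left (Nat.cast_ne_zero.2 Fintype.card_ne_zero)
  apply Δ.coords.injective
  ext p
  rw [hαβ, hα, hβ]
  simp

/-- Ordered roots whose sum vanishes and whose moments about the first and the last side are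
`-1`. -/
def Normalized (a : Δ.RootIndex → ℝ) : Prop :=
  Δ.LexOrdered a ∧ ∑ p, a p = 0 ∧ Δ.moment Δ.firstSide a = -1 ∧ Δ.moment Δ.lastSide a = -1

lemma exists_normalized_rep {c : Δ.RootModuli} (hc : c ∈ Δ.rationalHarnack) :
    ∃ b : Δ.rootSet, Δ.Normalized b ∧ Δ.rootClass b = c := by
  obtain ⟨a, ha, rfl⟩ := hc
  obtain ⟨b, hb, hcl, hn⟩ := Δ.exists_normalized a ha
  exact ⟨b, ⟨hb, hn⟩, hcl⟩

variable {Δ} in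
lemma Normalized.mem_orderedRoots {a : Δ.RootIndex → ℝ} (ha : Δ.Normalized a) :
    Δ.coords.symm a ∈ Δ.orderedRoots := by
  change Δ.SideOrdered (Δ.coords (Δ.coords.symm a))
  rw [ContinuousLinearEquiv.apply_symm_apply]
  exact ha.1.sideOrdered

variable {Δ} in
lemma Normalized.sub_mem {a b : Δ.RootIndex → ℝ} (ha : Δ.Normalized a) (hb : Δ.Normalized b) :
    Δ.coords.symm a - Δ.coords.symm b ∈ Δ.normalizedDirections := by
  have h : ∀ i, Δ.moment i (a - b) = Δ.moment i a - Δ.moment i b := (Δ.momentMap · |>.map_sub a b)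
  rw [mem_normalizedDirections, ← map_sub, ContinuousLinearEquiv.apply_symm_apply]
  refine ⟨?_, ?_, ?_⟩
  · simp only [Pi.sub_apply, Finset.sum_sub_distrib, ha.2.1, hb.2.1, sub_self]
  · rw [h, ha.2.2.1, hb.2.2.1, sub_self]
  · rw [h, ha.2.2.2, hb.2.2.2, sub_self]

lemma rhoE_symm (a : Δ.RootIndex → ℝ) :
    Δ.rhoE (Δ.coords.symm a) = Δ.coords.symm (Δ.rho a) := by
  rw [rhoE, ContinuousLinearEquiv.apply_symm_apply]

/-! ### Smoothness, injectivity and the smooth inverse -/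

lemma smoothOn_rhoTilde (H : Set Δ.RootModuli) : Δ.SmoothOn H Δ.rhoTilde := fun a _ =>
  ⟨Δ.rootSet, Δ.isOpen_rootSet, a.2, fun b => Δ.translations.mkQL (Δ.rho b),
    Δ.translations.mkQL.contDiff.comp_contDiffOn Δ.contDiffOn_rho, fun _ _ _ => rfl⟩

lemma injOn_rhoTilde : Set.InjOn Δ.rhoTilde Δ.rationalHarnack := by
  intro c hc c' hc' h
  obtain ⟨a, ha, rfl⟩ := Δ.exists_normalized_rep hc
  obtain ⟨b, hb, rfl⟩ := Δ.exists_normalized_rep hc'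
  have h1 : Δ.rho a - Δ.rho b ∈ Δ.translations := (Submodule.Quotient.eq _).1 h
  have h2 := eq_of_sub_mem_orthogonal Δ.convex_orderedRoots (fun _ => Δ.hasFDerivAt_rhoE)
    (fun _ ha _ => Δ.inner_rhoEDeriv_pos ha) ha.mem_orderedRoots hb.mem_orderedRoots
    (ha.sub_mem hb) (Δ.mem_orthogonal_of_mem_translations (by
      rwa [rhoE_symm, rhoE_symm, ← map_sub, ContinuousLinearEquiv.apply_symm_apply]))
  rw [Subtype.ext (Δ.coords.symm.injective h2)]

/-- A set-theoretic inverse of the restriction of `rhoTilde` is smooth. -/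
lemma smoothInto_inverse {G : Δ.TentacleSpace → Δ.RootModuli}
    (hG : ∀ c ∈ Δ.rationalHarnack, G (Δ.rhoTilde c) = c) :
    Δ.SmoothInto (Δ.rhoTilde '' Δ.rationalHarnack) G := by
  rintro y ⟨c, hc, rfl⟩
  obtain ⟨a, ha, rfl⟩ := Δ.exists_normalized_rep hc
  obtain ⟨U, hU, haU, f, hf, hfb⟩ := exists_smooth_inverse Δ.isOpen_orderedRoots
    Δ.convex_orderedRoots (fun _ => Δ.hasFDerivAt_rhoE) Δ.contDiffOn_rhoE
    (fun _ ha _ => Δ.inner_rhoEDeriv_pos ha) ha.mem_orderedRoots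
  -- Any linear lift will do: lifts differ by translations, and the local inverse sees values only
  -- modulo `normalizedDirectionsᗮ`.
  obtain ⟨σ, hσ⟩ := Δ.translations.mkQ.exists_rightInverse_of_surjective
    (LinearMap.range_eq_top.2 Δ.translations.mkQ_surjective)
  set τ : Δ.TentacleSpace →L[ℝ] EuclideanSpace ℝ Δ.RootIndex :=
    (Δ.coords.symm : (Δ.RootIndex → ℝ) →L[ℝ] EuclideanSpace ℝ Δ.RootIndex).comp
      (LinearMap.toContinuousLinearMap σ) with hτ
  have key : ∀ b : Δ.rootSet,
      τ (Δ.rhoTilde (Δ.rootClass b)) - Δ.rhoE (Δ.coords.symm b) ∈ Δ.normalizedDirectionsᗮ := by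
    intro b
    apply Δ.mem_orthogonal_of_mem_translations
    rw [rhoE_symm]
    change Δ.coords (Δ.coords.symm (σ (Δ.translations.mkQ (Δ.rho b))) -
      Δ.coords.symm (Δ.rho b)) ∈ _
    rw [← map_sub, ContinuousLinearEquiv.apply_symm_apply, ← Submodule.Quotient.eq]
    exact LinearMap.congr_fun hσ _
  refine ⟨τ ⁻¹' U, hU.preimage τ.continuous, haU _ (key a), fun z => Δ.coords (f (τ z)),
    Δ.coords.contDiff.comp_contDiffOn
      (hf.comp τ.contDiff.contDiffOn (Set.mapsTo_preimage _ _)), ?_⟩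
  rintro z ⟨⟨c, hc, rfl⟩, hzU⟩
  obtain ⟨b, hb, rfl⟩ := Δ.exists_normalized_rep hc
  have e : Δ.coords (f (τ (Δ.rhoTilde (Δ.rootClass b)))) = b := by
    rw [hfb _ hzU _ hb.mem_orderedRoots (hb.sub_mem ha) (key b),
      ContinuousLinearEquiv.apply_symm_apply]
  refine ⟨by beta_reduce; rw [e]; exact b.2, ?_⟩
  rw [hG _ hc]
  exact congrArg Δ.rootClass (Subtype.ext e)

/-- `Function.invFunOn` needs a default value off the image. -/
lemma nonempty_rootModuli : Nonempty Δ.RootModuli := by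
  have h : Δ.SideOrdered fun p => (p.1.val : ℝ) := fun _ _ h => Nat.cast_lt.2 h
  exact ⟨Δ.rootClass ⟨_, h.mem_rootSet⟩⟩

end LatticePolygon

end

theorem mainTheorem3 {m : ℕ} (Δ : LatticePolygon m) :
    Δ.IsDiffeoOntoImage Δ.rationalHarnack Δ.rhoTilde := by
  have := Δ.nonempty_rootModuli
  have hG : ∀ c ∈ Δ.rationalHarnack,
      Function.invFunOn Δ.rhoTilde Δ.rationalHarnack (Δ.rhoTilde c) = c := fun _ hc =>
    Δ.injOn_rhoTilde.leftInvOn_invFunOn hc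
  exact ⟨Δ.smoothOn_rhoTilde _, _, hG, Δ.smoothInto_inverse hG⟩
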